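/- Let $d\ge 3$, let $\gamma(t)=(t,t^2,\dots,t^{d-1})$, and for nonnegative $f$ on $\mathbb{R}^d=\mathbb{R}\times\mathbb{R}^{d-1}$ put $$Xf(t,y)=\int_{\mathbb{R}} f(s,y+s\gamma(t))\,ds,\qquad (t,y)\in\mathbb{R}\times\mathbb{R}^{d-1}.$$ For $\theta\in(0,1)$ define $p_\theta,q_\theta,r_\theta$ by $$\Big(\frac1{p_\theta},\frac1{q_\theta},\frac1{r_\theta}\Big)=\Big(1-\theta+\frac{\theta d}{d+2},\ \frac{\theta d}{d+2},\ 1-\theta+\frac{\theta(d^2-d-2)}{d^2+d-2}\Big),$$ let $q_\theta',r_\theta'$ be the dual exponents, and write $\|g\|_{L^q_tL^r_y}=\big(\int_{\mathbb{R}}(\int_{\mathbb{R}^{d-1}} g(t,y)^r\,dy)^{q/r}\,dt\big)^{1/q}$ for nonnegative $g$. For all constants $a,b,m,M>0$ there exist constants $c,C,k>0$, depending only on $d,\theta,a,b,m,M$, such that the following holds. Let $\epsilon>0$, let $E_1,E_2,F\subset\mathbb{R}^d$ be Lebesgue measurable sets of positive finite measure, and suppose that for some $A>0$ and $T\subset\mathbb{R}$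 $$m\,A\,\chi_T(t)\ \le\ \|\chi_F(t,\cdot)\|_{L_y^{r_\theta'}}^{r_\theta'}\ \le\ M\,A\,\chi_T(t)\qquad\text{for almost every } t\in\mathbb{R}.$$ Let $\tilde F\subset F$ be measurable with $|\tilde F|\ge a\,\epsilon^{b}|F|$, and suppose that for $i=1,2$ $$X\chi_{E_i}\ \ge\ \epsilon\,|E_i|^{1/p_\theta}\,\|\chi_F\|_{L_t^{q_\theta'}L_y^{r_\theta'}}\,|F|^{-1}\qquad\text{almost everywhere on }\tilde F.$$ Then $$c\,\epsilon^{k}|E_1|\ \le\ |E_2|\ \le\ C\,\epsilon^{-k}|E_1|.$$ -/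

import Mathlib

open MeasureTheory
open scoped ENNReal

noncomputable section

namespace RestrictedXray

/-- `ℝ^d` split as `ℝ × ℝ^{d-1}`, with its product (that is, `d`-dimensional Lebesgue) measure.
Points are written `(s, x)` on the side of functions and `(t, y)` on the side of lines. -/
abbrev Space (d : ℕ) : Type := ℝ × (Fin (d - 1) → ℝ)

/-- The moment curve `γ(t) = (t, t^2, ..., t^{d-1})` in `ℝ^{d-1}`. -/
def momentCurve (d : ℕ) (t : ℝ) : Fin (d - 1) → ℝ := fun i => t ^ ((i : ℕ) + 1)

/-- The restricted X-ray transform `X f (t, y) = ∫ f (s, y + s γ(t)) ds` of a nonnegative `f`. -/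
def xray (d : ℕ) (f : Space d → ℝ≥0∞) (z : Space d) : ℝ≥0∞ :=
  ∫⁻ s : ℝ, f (s, z.2 + s • momentCurve d z.1)

/-- The characteristic function of a set, with values in `[0, ∞]`. -/
def chi {d : ℕ} (E : Set (Space d)) : Space d → ℝ≥0∞ := E.indicator (fun _ => 1)

/-- The norm in `y` at fixed `t`: `‖g(t, ·)‖_{L_y^r}`. -/
def fibreNorm {d : ℕ} (r : ℝ) (g : Space d → ℝ≥0∞) (t : ℝ) : ℝ≥0∞ :=
  eLpNorm (fun y : Fin (d - 1) → ℝ => g (t, y)) (ENNReal.ofReal r) volume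

/-- The mixed norm `‖g‖_{L_t^q L_y^r}`. -/
def mixedNorm {d : ℕ} (q r : ℝ) (g : Space d → ℝ≥0∞) : ℝ≥0∞ :=
  eLpNorm (fibreNorm r g) (ENNReal.ofReal q) volume

/-- `p_θ`, where `1 / p_θ = 1 - θ + θ d / (d + 2)`. -/
def pExp (d : ℕ) (θ : ℝ) : ℝ := (1 - θ + θ * d / (d + 2))⁻¹

/-- `q_θ`, where `1 / q_θ = θ d / (d + 2)`. -/
def qExp (d : ℕ) (θ : ℝ) : ℝ := (θ * d / (d + 2))⁻¹

/-- `r_θ`, where `1 / r_θ = 1 - θ + θ (d^2 - d - 2) / (d^2 + d - 2)`. -/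
def rExp (d : ℕ) (θ : ℝ) : ℝ :=
  (1 - θ + θ * ((d : ℝ) ^ 2 - d - 2) / ((d : ℝ) ^ 2 + d - 2))⁻¹

/-- The dual exponent `q_θ'`. -/
def qDual (d : ℕ) (θ : ℝ) : ℝ := Real.conjExponent (qExp d θ)

/-- The dual exponent `r_θ'`. -/
def rDual (d : ℕ) (θ : ℝ) : ℝ := Real.conjExponent (rExp d θ)

/-- The natural size `ε |E|^{1/p_θ} ‖χ_F‖_{L_t^{q_θ'} L_y^{r_θ'}} |F|⁻¹` of `X χ_E` on `F`. -/
def threshold (d : ℕ) (θ ε : ℝ) (E F : Set (Space d)) : ℝ≥0∞ :=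
  ENNReal.ofReal ε * volume E ^ (1 / pExp d θ) *
    mixedNorm (qDual d θ) (rDual d θ) (chi F) * (volume F)⁻¹

/-- `‖χ_F(t, ·)‖_{L_y^{r}}^{r} ∼ A χ_T(t)` for almost every `t`, with comparability constants
`m` (lower) and `M` (upper). -/
def FibreComparable {d : ℕ} (m M r A : ℝ) (T : Set ℝ) (F : Set (Space d)) : Prop :=
  ∀ᵐ t : ℝ,
    T.indicator (fun _ => ENNReal.ofReal (m * A)) t ≤ fibreNorm r (chi F) t ^ r ∧
    fibreNorm r (chi F) t ^ r ≤ T.indicator (fun _ => ENNReal.ofReal (M * A)) t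

end RestrictedXray

end

noncomputable section

namespace RestrictedXray


/-! Both sets are compared with one critical size that depends on `F` alone: A^{d/(d-1)} τ^{-d/2},
where τ is the measure of the set of `t` with nonempty fibres, up to null sets. Put u = 2θ/(d+2) and
let ρ be |E| divided by the critical size. The hypothesis then says that almost every line of `F'`
meets E in measure at least α ≈ ε (|E|/A) ρ^{-u}. It suffices to bound ρ above and below by powers
of ε, for any such E (`log_volume_bounds`).

Lower bound: the lines of `F'` through a point have measure at most τ, so double counting of
incidences gives α|F'| ≤ τ|E| (`mul_volume_le_volume_mul`). Since |F'| ≳ ε^b A τ, this is ρ^u ≳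
ε^{1+b}.

Upper bound: this is the method of refinements. Let n = d-1. A typical point of E lies on lines of
`F'` of measure β ≈ α|F'|/|E|. After n refinements some line f remains from which one can pass n
times to a point of E and then to another line, ending in `F'`, with a set of choices of measure at
least about (αβ)^n, even if all line parameters are kept δ ≈ β apart (`pow_le_volume_pathSet`).
Conversely, for fixed line parameters the endpoint is affine in the n point parameters, with a
Vandermonde determinant, and it lies in a fibre of measure at most MA (`volume_endpoint_fibre`).
Integrating A/|det| over the line parameters bounds the same measure above (`volume_pathSet_le`).
The two counts give ρ^{1-Pu} ≲ ε^{-k}, where P = (d+2)/2 + η and Pu = θ + ηu. For small η > 0 this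
is less than 1, because θ < 1. -/

/-! ### Integration over finite powers of a measure space. -/

theorem lintegral_fin_cons {α : Type*} [MeasureSpace α] [SigmaFinite (volume : Measure α)] {k : ℕ}
    (f : (Fin (k + 1) → α) → ℝ≥0∞) (hf : Measurable f) :
    ∫⁻ p, f p = ∫⁻ q, ∫⁻ p : Fin k → α, f (Fin.cons q p) := by
  have h := (volume_preserving_piFinSuccAbove (fun _ : Fin (k + 1) => α) 0).symm
  rw [← h.lintegral_comp hf, Measure.volume_eq_prod, lintegral_prod]
  · simp [MeasurableEquiv.piFinSuccAbove_symm_apply, Fin.insertNthEquiv]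
  · exact (hf.comp (MeasurableEquiv.measurable _)).aemeasurable

theorem measurable_fin_cons {α : Type*} [MeasurableSpace α] {k : ℕ} :
    Measurable fun z : α × (Fin k → α) => (Fin.cons z.1 z.2 : Fin (k + 1) → α) := by
  refine measurable_pi_lambda _ fun i => ?_
  refine Fin.cases ?_ (fun j => ?_) i
  · simpa using measurable_fst
  · simp only [Fin.cons_succ]; fun_prop

theorem volume_fin_cons {α : Type*} [MeasureSpace α] [SigmaFinite (volume : Measure α)] {k : ℕ}
    {S : Set (Fin (k + 1) → α)} (hS : MeasurableSet S) :
    volume S = ∫⁻ q, volume {p : Fin k → α | Fin.cons q p ∈ S} := by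
  rw [← lintegral_indicator_one hS, lintegral_fin_cons _ (measurable_one.indicator hS)]
  refine lintegral_congr fun q => ?_
  have : MeasurableSet {p : Fin k → α | Fin.cons q p ∈ S} :=
    (measurable_fin_cons.comp (measurable_const.prodMk measurable_id)) hS
  rw [← lintegral_indicator_one this]
  rfl

theorem lintegral_prod_pow {α : Type*} [MeasureSpace α] [SigmaFinite (volume : Measure α)]
    {g : α → ℝ≥0∞} (hg : Measurable g) (k : ℕ) :
    ∫⁻ p : Fin k → α, ∏ i, g (p i) = (∫⁻ q, g q) ^ k := by
  induction k with
  | zero => simp [Measure.volume_pi_eq_dirac (default : Fin 0 → α)]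
  | succ k ih =>
    rw [lintegral_fin_cons _ (by fun_prop)]
    have hm : Measurable fun p : Fin k → α => ∏ i, g (p i) := by fun_prop
    simp_rw [Fin.prod_univ_succ, Fin.cons_zero, Fin.cons_succ, lintegral_const_mul _ hm, ih]
    rw [lintegral_mul_const _ hg, pow_succ']

/-! ### Lines, points and their incidences. -/

/-- The moment curve in `ℝ^n`. -/
def curve (n : ℕ) (t : ℝ) : Fin n → ℝ := fun i => t ^ ((i : ℕ) + 1)

/-- The point with parameter `s` on the line `f`. -/
def onLine {n : ℕ} (f : ℝ × (Fin n → ℝ)) (s : ℝ) : ℝ × (Fin n → ℝ) := (s, f.2 + s • curve n f.1)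

/-- The line with parameter `t` through the point `z`. -/
def through {n : ℕ} (z : ℝ × (Fin n → ℝ)) (t : ℝ) : ℝ × (Fin n → ℝ) := (t, z.2 - z.1 • curve n t)

variable {n : ℕ}

theorem measurable_onLine : Measurable fun w : (ℝ × (Fin n → ℝ)) × ℝ => onLine w.1 w.2 := by
  unfold onLine
  refine measurable_snd.prodMk (measurable_pi_lambda _ fun i => ?_)
  simp only [Pi.add_apply, Pi.smul_apply, curve, smul_eq_mul]
  fun_prop

theorem measurable_through : Measurable fun w : (ℝ × (Fin n → ℝ)) × ℝ => through w.1 w.2 := by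
  unfold through
  refine measurable_snd.prodMk (measurable_pi_lambda _ fun i => ?_)
  simp only [Pi.sub_apply, Pi.smul_apply, curve, smul_eq_mul]
  fun_prop

/-- The X-ray transform of the indicator of a set. -/
def lineMeasure (E : Set (ℝ × (Fin n → ℝ))) (f : ℝ × (Fin n → ℝ)) : ℝ≥0∞ :=
  volume (onLine f ⁻¹' E)

/-- The dual X-ray transform of the indicator of a set. -/
def pencilMeasure (F : Set (ℝ × (Fin n → ℝ))) (z : ℝ × (Fin n → ℝ)) : ℝ≥0∞ :=
  volume (through z ⁻¹' F)

theorem measurable_lineMeasure {E : Set (ℝ × (Fin n → ℝ))} (hE : MeasurableSet E) :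
    Measurable (lineMeasure E) :=
  measurable_measure_prodMk_left (measurable_onLine hE)

theorem measurable_pencilMeasure {F : Set (ℝ × (Fin n → ℝ))} (hF : MeasurableSet F) :
    Measurable (pencilMeasure F) :=
  measurable_measure_prodMk_left (measurable_through hF)

/-- Both sides measure the incidences between `E` and `F`: for fixed `s` and `t` the substitution x
= y + sγ(t) is a translation, and the rest is Tonelli. -/
theorem setLIntegral_lineMeasure_eq {E F : Set (ℝ × (Fin n → ℝ))} (hE : MeasurableSet E)
    (hF : MeasurableSet F) :
    ∫⁻ f in F, lineMeasure E f = ∫⁻ z in E, pencilMeasure F z := by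
  have h1 : ∫⁻ f in F, lineMeasure E f = ∫⁻ t : ℝ, ∫⁻ y : Fin n → ℝ, ∫⁻ s : ℝ,
      F.indicator 1 (t, y) * E.indicator 1 (s, y + s • curve n t) := by
    rw [← lintegral_indicator hF, Measure.volume_eq_prod, lintegral_prod _
      ((measurable_lineMeasure hE).indicator hF).aemeasurable]
    refine lintegral_congr fun t => lintegral_congr fun y => ?_
    have hm : Measurable fun s : ℝ => E.indicator (1 : ℝ × (Fin n → ℝ) → ℝ≥0∞)
        (s, y + s • curve n t) :=
      (measurable_one.indicator hE).comp (measurable_onLine.comp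
        (measurable_const (a := (t, y)) |>.prodMk measurable_id))
    rw [lintegral_const_mul _ hm]
    have : ∫⁻ s : ℝ, E.indicator (1 : ℝ × (Fin n → ℝ) → ℝ≥0∞) (s, y + s • curve n t)
        = lineMeasure E (t, y) := by
      rw [lineMeasure, ← lintegral_indicator_one]
      · rfl
      · exact (measurable_onLine.comp (measurable_const.prodMk measurable_id)) hE
    rw [this]
    by_cases h : (t, y) ∈ F <;> simp [h]
  have h2 : ∫⁻ z in E, pencilMeasure F z = ∫⁻ s : ℝ, ∫⁻ x : Fin n → ℝ, ∫⁻ t : ℝ,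
      F.indicator 1 (t, x - s • curve n t) * E.indicator 1 (s, x) := by
    rw [← lintegral_indicator hE, Measure.volume_eq_prod, lintegral_prod _
      ((measurable_pencilMeasure hF).indicator hE).aemeasurable]
    refine lintegral_congr fun s => lintegral_congr fun x => ?_
    have hm : Measurable fun t : ℝ => F.indicator (1 : ℝ × (Fin n → ℝ) → ℝ≥0∞)
        (t, x - s • curve n t) :=
      (measurable_one.indicator hF).comp (measurable_through.comp
        (measurable_const (a := (s, x)) |>.prodMk measurable_id))
    rw [lintegral_mul_const _ hm]
    have : ∫⁻ t : ℝ, F.indicator (1 : ℝ × (Fin n → ℝ) → ℝ≥0∞) (t, x - s • curve n t)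
        = pencilMeasure F (s, x) := by
      rw [pencilMeasure, ← lintegral_indicator_one]
      · rfl
      · exact (measurable_through.comp (measurable_const.prodMk measurable_id)) hF
    rw [this]
    by_cases h : (s, x) ∈ E <;> simp [h]
  have hF1 : Measurable (F.indicator (1 : ℝ × (Fin n → ℝ) → ℝ≥0∞)) := measurable_one.indicator hF
  have hE1 : Measurable (E.indicator (1 : ℝ × (Fin n → ℝ) → ℝ≥0∞)) := measurable_one.indicator hE
  rw [h1, h2]
  calc _ = ∫⁻ t : ℝ, ∫⁻ s : ℝ, ∫⁻ y : Fin n → ℝ,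
        F.indicator 1 (t, y) * E.indicator 1 (s, y + s • curve n t) := by
        refine lintegral_congr fun t => lintegral_lintegral_swap ?_
        refine Measurable.aemeasurable ?_
        refine (hF1.comp (measurable_const.prodMk measurable_fst)).mul (hE1.comp ?_)
        exact measurable_onLine.comp (((measurable_const (a := t)).prodMk measurable_fst).prodMk
          measurable_snd)
    _ = ∫⁻ t : ℝ, ∫⁻ s : ℝ, ∫⁻ x : Fin n → ℝ,
        F.indicator 1 (t, x - s • curve n t) * E.indicator 1 (s, x) := by
        refine lintegral_congr fun t => lintegral_congr fun s => ?_
        rw [← lintegral_add_right_eq_self (μ := (volume : Measure (Fin n → ℝ)))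
          (fun x => F.indicator 1 (t, x - s • curve n t) * E.indicator 1 (s, x)) (s • curve n t)]
        simp
    _ = ∫⁻ s : ℝ, ∫⁻ t : ℝ, ∫⁻ x : Fin n → ℝ,
        F.indicator 1 (t, x - s • curve n t) * E.indicator 1 (s, x) := by
        refine lintegral_lintegral_swap ?_
        refine (Measurable.lintegral_prod_right' (f := fun w : (ℝ × ℝ) × (Fin n → ℝ) =>
          F.indicator 1 (w.1.1, w.2 - w.1.2 • curve n w.1.1) * E.indicator 1 (w.1.2, w.2))
          ?_).aemeasurable
        refine (hF1.comp ?_).mul (hE1.comp (by fun_prop))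
        exact measurable_through.comp
          (((measurable_snd.comp measurable_fst).prodMk measurable_snd).prodMk
            (measurable_fst.comp measurable_fst))
    _ = _ := by
        refine lintegral_congr fun s => lintegral_lintegral_swap ?_
        refine Measurable.aemeasurable ?_
        refine (hF1.comp ?_).mul (hE1.comp (by fun_prop))
        exact measurable_through.comp (((measurable_const (a := s)).prodMk measurable_snd).prodMk
          measurable_fst)

/-- Double counting against the set of all lines, applied to a measurable null superset of `N`. -/
theorem ae_lineMeasure_eq_zero {N : Set (ℝ × (Fin n → ℝ))} (hN : volume N = 0) :
    ∀ᵐ f : ℝ × (Fin n → ℝ), lineMeasure N f = 0 := by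
  have hm := measurableSet_toMeasurable volume N
  have h := setLIntegral_lineMeasure_eq hm (MeasurableSet.univ (α := ℝ × (Fin n → ℝ)))
  rw [setLIntegral_measure_zero (toMeasurable volume N) _ (by rw [measure_toMeasurable, hN]),
    Measure.restrict_univ, lintegral_eq_zero_iff (measurable_lineMeasure hm)] at h
  filter_upwards [h] with f hf
  exact measure_mono_null (Set.preimage_mono (subset_toMeasurable _ _)) hf

/-! ### Paths and the Vandermonde determinant. -/

/-- Passing from the line `f` to the line with parameter `p.2` through its point with
parameter `p.1`. -/
def step (f : ℝ × (Fin n → ℝ)) (p : ℝ × ℝ) : ℝ × (Fin n → ℝ) := through (onLine f p.1) p.2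

/-- The line parameters met along a path. -/
def times {k : ℕ} (t₀ : ℝ) (p : Fin k → ℝ × ℝ) : Fin (k + 1) → ℝ :=
  Fin.cons t₀ fun i => (p i).2

/-- The line reached from `f` along the path `p`. -/
def endpoint {k : ℕ} (f : ℝ × (Fin n → ℝ)) (p : Fin k → ℝ × ℝ) : ℝ × (Fin n → ℝ) :=
  (times f.1 p (Fin.last k), f.2 + ∑ i : Fin k, (p i).1 •
    (curve n (times f.1 p i.castSucc) - curve n (times f.1 p i.succ)))

theorem endpoint_zero (f : ℝ × (Fin n → ℝ)) (p : Fin 0 → ℝ × ℝ) : endpoint f p = f := by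
  simp [endpoint, times, Fin.last]

theorem times_cons {k : ℕ} (t₀ : ℝ) (q : ℝ × ℝ) (p : Fin k → ℝ × ℝ) :
    times t₀ (Fin.cons q p : Fin (k + 1) → ℝ × ℝ) = Fin.cons t₀ (times q.2 p) := by
  unfold times
  congr 1
  ext i
  refine Fin.cases ?_ (fun j => ?_) i <;> simp

/-- The closed formula for `endpoint` is the iteration of `step`: its first summand is the change of
the second component made by one step. The recursion serves the lower count of paths, the closed
formula the upper count. -/
theorem endpoint_cons {k : ℕ} (f : ℝ × (Fin n → ℝ)) (q : ℝ × ℝ) (p : Fin k → ℝ × ℝ) :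
    endpoint f (Fin.cons q p : Fin (k + 1) → ℝ × ℝ) = endpoint (step f q) p := by
  unfold endpoint
  rw [times_cons]
  have h0 : times q.2 p 0 = q.2 := rfl
  refine Prod.ext ?_ ?_
  · simp [← Fin.succ_last, step, through]
  · simp only [Fin.sum_univ_succ, Fin.cons_zero, Fin.cons_succ, Fin.castSucc_zero, h0,
      ← Fin.succ_castSucc, step, through, onLine, smul_sub]
    abel

theorem measurable_times {k : ℕ} (t₀ : ℝ) (i : Fin (k + 1)) :
    Measurable fun p : Fin k → ℝ × ℝ => times t₀ p i := by
  unfold times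
  refine Fin.cases ?_ (fun j => ?_) i
  · simp
  · simp only [Fin.cons_succ]; fun_prop

theorem measurable_endpoint {k : ℕ} (f : ℝ × (Fin n → ℝ)) :
    Measurable fun p : Fin k → ℝ × ℝ => endpoint f p := by
  unfold endpoint
  refine (measurable_times _ _).prodMk (measurable_pi_lambda _ fun j => ?_)
  simp only [Pi.add_apply, Finset.sum_apply, Pi.smul_apply, Pi.sub_apply, smul_eq_mul, curve]
  have h := fun i => measurable_times (k := k) f.1 i
  fun_prop

/-- The matrix of successive differences of the moment curve. -/
def diffMatrix (v : Fin (n + 1) → ℝ) : Matrix (Fin n) (Fin n) ℝ :=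
  fun i j => curve n (v i.succ) j - curve n (v i.castSucc) j

/-- Subtracting from each row of the Vandermonde matrix its predecessor leaves (1, 0, ..., 0) as
first column; expanding along it leaves `diffMatrix`. -/
theorem det_diffMatrix (v : Fin (n + 1) → ℝ) :
    (diffMatrix v).det = ∏ i : Fin (n + 1), ∏ j ∈ Finset.Ioi i, (v j - v i) := by
  rw [← Matrix.det_vandermonde]
  let B : Matrix (Fin (n + 1)) (Fin (n + 1)) ℝ := fun i j =>
    Fin.cases (v 0 ^ (j : ℕ)) (fun i' => v i'.succ ^ (j : ℕ) - v i'.castSucc ^ (j : ℕ)) i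
  have h : (Matrix.vandermonde v).det = B.det := by
    refine Matrix.det_eq_of_forall_row_eq_smul_add_pred (fun _ => 1) (fun j => ?_) fun i j => ?_
    · simp [B, Matrix.vandermonde]
    · simp [B, Matrix.vandermonde]
  rw [h, Matrix.det_succ_column_zero, Fin.sum_univ_succ, Finset.sum_eq_zero]
  · simp only [B, Fin.cases_zero, Fin.val_zero, pow_zero, one_mul, add_zero]
    congr 1
  · intro i _
    simp [B]

/-- The endpoint of a path with prescribed line parameters depends affinely on the
point parameters, with Vandermonde determinant. -/
theorem volume_endpoint_fibre (v : Fin (n + 1) → ℝ) (hv : (diffMatrix v).det ≠ 0)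
    (y : Fin n → ℝ) (S : Set (Fin n → ℝ)) :
    volume {s : Fin n → ℝ | y + ∑ i, s i • (curve n (v i.castSucc) - curve n (v i.succ)) ∈ S} =
      ENNReal.ofReal |(diffMatrix v).det|⁻¹ * volume S := by
  let L := Matrix.toLin' (-(diffMatrix v).transpose)
  have hd : |LinearMap.det L| = |(diffMatrix v).det| := by
    rw [LinearMap.det_toLin', Matrix.det_neg, abs_mul, Matrix.det_transpose]; simp
  have hL : LinearMap.det L ≠ 0 := by
    rw [← abs_pos, hd, abs_pos]; exact hv
  have hLs : ∀ s, L s = ∑ i, s i • (curve n (v i.castSucc) - curve n (v i.succ)) := by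
    intro s
    ext j
    simp only [L, Matrix.toLin'_apply, Matrix.mulVec, dotProduct, Matrix.neg_apply,
      Matrix.transpose_apply, diffMatrix, Finset.sum_apply, Pi.smul_apply, Pi.sub_apply,
      smul_eq_mul]
    exact Finset.sum_congr rfl fun i _ => by ring
  have : {s : Fin n → ℝ | y + ∑ i, s i • (curve n (v i.castSucc) - curve n (v i.succ)) ∈ S} =
      L ⁻¹' ((fun x => y + x) ⁻¹' S) := by
    ext s; simp [hLs]
  rw [this, Measure.addHaar_preimage_linearMap _ hL, measure_preimage_add, abs_inv, hd]

/-! ### Refinement of a set of lines. -/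

/-- The points of `E` that lie on many lines of `F`. -/
def richPoints (E : Set (ℝ × (Fin n → ℝ))) (b : ℝ≥0∞) (F : Set (ℝ × (Fin n → ℝ))) :
    Set (ℝ × (Fin n → ℝ)) := E ∩ {z | b ≤ pencilMeasure F z}

/-- The lines of `F` that contain many rich points of `E`. -/
def richLines (E : Set (ℝ × (Fin n → ℝ))) (a b : ℝ≥0∞) (F : Set (ℝ × (Fin n → ℝ))) :
    Set (ℝ × (Fin n → ℝ)) := F ∩ {f | a ≤ lineMeasure (richPoints E b F) f}

theorem measurableSet_richPoints {E F : Set (ℝ × (Fin n → ℝ))} (hE : MeasurableSet E)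
    (hF : MeasurableSet F) (b : ℝ≥0∞) : MeasurableSet (richPoints E b F) :=
  hE.inter (measurableSet_le measurable_const (measurable_pencilMeasure hF))

theorem measurableSet_richLines {E F : Set (ℝ × (Fin n → ℝ))} (hE : MeasurableSet E)
    (hF : MeasurableSet F) (a b : ℝ≥0∞) : MeasurableSet (richLines E a b F) :=
  hF.inter (measurableSet_le measurable_const
    (measurable_lineMeasure (measurableSet_richPoints hE hF b)))

theorem setLIntegral_le_inter_add {α : Type*} [MeasurableSpace α] {μ : Measure α} {S : Set α}
    {g : α → ℝ≥0∞} (hS : MeasurableSet S) (hg : Measurable g) (b : ℝ≥0∞) :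
    ∫⁻ x in S, g x ∂μ ≤ ∫⁻ x in S ∩ {x | b ≤ g x}, g x ∂μ + b * μ S := by
  rw [← lintegral_inter_add_sdiff g S (measurableSet_le measurable_const hg)]
  gcongr
  calc ∫⁻ x in S \ {x | b ≤ g x}, g x ∂μ ≤ ∫⁻ _ in S \ {x | b ≤ g x}, b ∂μ := by
        refine setLIntegral_mono' (hS.diff (measurableSet_le measurable_const hg)) ?_
        rintro x ⟨-, hx⟩
        exact (not_le.1 hx).le
    _ ≤ b * μ S := by
        rw [setLIntegral_const]; gcongr; exact Set.sdiff_subset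

/-- Discarding poor points costs at most `b * volume E` incidences. After double counting back to
lines, discarding poor lines costs at most `a * volume F` more. -/
theorem setLIntegral_richLines {E F : Set (ℝ × (Fin n → ℝ))} (hE : MeasurableSet E)
    (hF : MeasurableSet F) (a b : ℝ≥0∞) :
    ∫⁻ f in F, lineMeasure E f ≤
      (∫⁻ f in richLines E a b F, lineMeasure E f) + (b * volume E + a * volume F) := by
  have hR := measurableSet_richPoints hE hF b
  calc ∫⁻ f in F, lineMeasure E f = ∫⁻ z in E, pencilMeasure F z :=
        setLIntegral_lineMeasure_eq hE hF
    _ ≤ (∫⁻ z in richPoints E b F, pencilMeasure F z) + b * volume E :=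
        setLIntegral_le_inter_add hE (measurable_pencilMeasure hF) b
    _ = (∫⁻ f in F, lineMeasure (richPoints E b F) f) + b * volume E := by
        rw [setLIntegral_lineMeasure_eq hR hF]
    _ ≤ ((∫⁻ f in richLines E a b F, lineMeasure (richPoints E b F) f) + a * volume F)
          + b * volume E := by
        gcongr
        exact setLIntegral_le_inter_add hF (measurable_lineMeasure hR) a
    _ ≤ ((∫⁻ f in richLines E a b F, lineMeasure E f) + a * volume F) + b * volume E := by
        gcongr with f
        exact measure_mono (Set.preimage_mono Set.inter_subset_left)
    _ = _ := by rw [add_assoc, add_comm (a * _)]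

/-- The iterated refinements of a set of lines. -/
def refined (E : Set (ℝ × (Fin n → ℝ))) (a b : ℝ≥0∞) (G : Set (ℝ × (Fin n → ℝ))) (k : ℕ) :
    Set (ℝ × (Fin n → ℝ)) := (richLines E a b)^[k] G

theorem refined_succ (E : Set (ℝ × (Fin n → ℝ))) (a b : ℝ≥0∞) (G : Set (ℝ × (Fin n → ℝ)))
    (k : ℕ) : refined E a b G (k + 1) = richLines E a b (refined E a b G k) :=
  Function.iterate_succ_apply' _ _ _

theorem measurableSet_refined {E G : Set (ℝ × (Fin n → ℝ))} (hE : MeasurableSet E)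
    (hG : MeasurableSet G) (a b : ℝ≥0∞) (k : ℕ) : MeasurableSet (refined E a b G k) := by
  induction k with
  | zero => exact hG
  | succ k ih => rw [refined_succ]; exact measurableSet_richLines hE ih a b

theorem refined_subset (E : Set (ℝ × (Fin n → ℝ))) (a b : ℝ≥0∞) (G : Set (ℝ × (Fin n → ℝ)))
    (k : ℕ) : refined E a b G k ⊆ G := by
  induction k with
  | zero => exact subset_rfl
  | succ k ih => rw [refined_succ]; exact Set.inter_subset_left.trans ih

theorem refined_nonempty {E G : Set (ℝ × (Fin n → ℝ))} (hE : MeasurableSet E)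
    (hG : MeasurableSet G) (a b : ℝ≥0∞) (k : ℕ)
    (h : k * (b * volume E + a * volume G) < ∫⁻ f in G, lineMeasure E f) :
    (refined E a b G k).Nonempty := by
  have key : ∀ j : ℕ, ∫⁻ f in G, lineMeasure E f ≤
      (∫⁻ f in refined E a b G j, lineMeasure E f) + j * (b * volume E + a * volume G) := by
    intro j
    induction j with
    | zero => simp [refined]
    | succ j ih =>
      have h1 := setLIntegral_richLines hE (measurableSet_refined hE hG a b j) a b
      rw [← refined_succ] at h1
      have h2 : a * volume (refined E a b G j) ≤ a * volume G := by
        gcongr; exact refined_subset E a b G j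
      calc _ ≤ _ := ih
        _ ≤ ((∫⁻ f in refined E a b G (j + 1), lineMeasure E f) +
              (b * volume E + a * volume G)) + j * (b * volume E + a * volume G) := by
            gcongr; exact h1.trans (by gcongr)
        _ = _ := by push_cast; ring
  by_contra hne
  rw [Set.not_nonempty_iff_eq_empty] at hne
  have := key k
  rw [hne] at this
  rw [Measure.restrict_empty, lintegral_zero_measure, zero_add] at this
  exact absurd h (not_lt.2 this)

/-! ### Lower bound for the measure of the paths. -/

/-- Paths of length `k` starting from `f`, with line parameters in `T` that are `δ`-separated
from each other and from `h`, and with endpoint in `G`. -/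
def pathSet (T : Set ℝ) (G : Set (ℝ × (Fin n → ℝ))) (δ : ℝ) (k : ℕ) (f : ℝ × (Fin n → ℝ))
    (h : Finset ℝ) : Set (Fin k → ℝ × ℝ) :=
  {p | (∀ i, (p i).2 ∈ T ∧ ∀ u ∈ h, δ ≤ |(p i).2 - u|) ∧
    (∀ i j, i ≠ j → δ ≤ |(p i).2 - (p j).2|) ∧ endpoint f p ∈ G}

theorem measurableSet_separated {α : Type*} [MeasurableSpace α] {g : α → ℝ} (hg : Measurable g)
    (δ : ℝ) (h : Finset ℝ) : MeasurableSet {x | ∀ u ∈ h, δ ≤ |g x - u|} := by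
  have : {x | ∀ u ∈ h, δ ≤ |g x - u|} = ⋂ u ∈ h, {x | δ ≤ |g x - u|} := by ext; simp
  rw [this]
  refine Finset.measurableSet_biInter h fun u _ => measurableSet_le measurable_const ?_
  simp_rw [← Real.norm_eq_abs]; fun_prop

theorem measurableSet_pathSet {T : Set ℝ} {G : Set (ℝ × (Fin n → ℝ))} (hT : MeasurableSet T)
    (hG : MeasurableSet G) (δ : ℝ) (k : ℕ) (f : ℝ × (Fin n → ℝ)) (h : Finset ℝ) :
    MeasurableSet (pathSet T G δ k f h) := by
  have : pathSet T G δ k f h =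
      (⋂ i : Fin k, {p | (p i).2 ∈ T} ∩ {p | ∀ u ∈ h, δ ≤ |(p i).2 - u|}) ∩
      ((⋂ i : Fin k, ⋂ j : Fin k, ⋂ _ : i ≠ j, {p | δ ≤ |(p i).2 - (p j).2|}) ∩
        {p | endpoint f p ∈ G}) := by
    ext; simp [pathSet]
  rw [this]
  refine .inter (.iInter fun i => .inter ?_ (measurableSet_separated (by fun_prop) _ _))
    (.inter (.iInter fun i => .iInter fun j => .iInter fun _ => ?_) (measurable_endpoint f hG))
  · exact (show Measurable fun p : Fin k → ℝ × ℝ => (p i).2 by fun_prop) hT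
  · exact measurableSet_le measurable_const
      (show Measurable fun p : Fin k → ℝ × ℝ => |(p i).2 - (p j).2| by
        simp_rw [← Real.norm_eq_abs]; fun_prop)

theorem cons_mem_pathSet {T : Set ℝ} {G : Set (ℝ × (Fin n → ℝ))} {δ : ℝ} {k : ℕ}
    {f : ℝ × (Fin n → ℝ)} {h : Finset ℝ} {q : ℝ × ℝ} (hqT : q.2 ∈ T)
    (hq : ∀ u ∈ h, δ ≤ |q.2 - u|) {p : Fin k → ℝ × ℝ}
    (hp : p ∈ pathSet T G δ k (step f q) (insert q.2 h)) :
    (Fin.cons q p : Fin (k + 1) → ℝ × ℝ) ∈ pathSet T G δ (k + 1) f h := by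
  obtain ⟨h1, h2, h3⟩ := hp
  refine ⟨fun i => ?_, ?_, ?_⟩
  · refine Fin.cases ⟨hqT, hq⟩ (fun i => ⟨(h1 i).1, ?_⟩) i
    exact fun u hu => (h1 i).2 u (Finset.mem_insert_of_mem hu)
  · intro i j
    refine Fin.cases ?_ (fun i => ?_) i <;> refine Fin.cases ?_ (fun j => ?_) j <;> intro hij
    · exact absurd rfl hij
    · simpa [abs_sub_comm] using (h1 j).2 q.2 (Finset.mem_insert_self _ _)
    · simpa using (h1 i).2 q.2 (Finset.mem_insert_self _ _)
    · simpa using h2 i j fun e => hij (by rw [e])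
  · rwa [endpoint_cons]

/-- The points excluded lie in `h.card` intervals of length 2δ, which together take at most half of
`b`. -/
theorem measure_separated {S : Set ℝ} (h : Finset ℝ) {b δ : ℝ}
    (hS : ENNReal.ofReal b ≤ volume S) (hδ : 4 * δ * h.card ≤ b) :
    ENNReal.ofReal (b / 2) ≤ volume (S ∩ {t | ∀ u ∈ h, δ ≤ |t - u|}) := by
  have h1 : volume S ≤ volume (S ∩ {t | ∀ u ∈ h, δ ≤ |t - u|}) +
      volume (⋃ u ∈ h, Set.Ioo (u - δ) (u + δ)) := by
    refine (measure_mono fun t ht => ?_).trans (measure_union_le _ _)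
    by_cases hh : ∀ u ∈ h, δ ≤ |t - u|
    · exact Or.inl ⟨ht, hh⟩
    · push Not at hh
      obtain ⟨u, hu, hlt⟩ := hh
      rw [abs_lt] at hlt
      exact Or.inr (Set.mem_biUnion hu ⟨by linarith, by linarith⟩)
  have h2 : volume (⋃ u ∈ h, Set.Ioo (u - δ) (u + δ)) ≤ ENNReal.ofReal (b / 2) := by
    refine (measure_biUnion_finset_le _ _).trans ?_
    have : ∀ u : ℝ, u + δ - (u - δ) = 2 * δ := fun u => by ring
    simp only [Real.volume_Ioo, this, Finset.sum_const, nsmul_eq_mul]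
    rw [← ENNReal.ofReal_natCast, ← ENNReal.ofReal_mul (by positivity)]
    exact ENNReal.ofReal_le_ofReal (by linarith)
  rcases le_or_gt b 0 with hb | hb
  · rw [ENNReal.ofReal_of_nonpos (by linarith)]; exact zero_le
  · have h3 := hS.trans (h1.trans (add_le_add_right h2 _))
    have h4 : ENNReal.ofReal b = ENNReal.ofReal (b / 2) + ENNReal.ofReal (b / 2) := by
      rw [← ENNReal.ofReal_add (by linarith) (by linarith), add_halves]
    rw [h4] at h3
    exact (ENNReal.add_le_add_iff_right ENNReal.ofReal_ne_top).1 h3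

/-- Each step spends one refinement: a line of generation k+1 has rich points of measure at least
`a`, and each of these lies on lines of generation k of measure at least `b`, half of which survive
the separation. The finite set `h` records the line parameters already used, and `N` bounds its
final size. -/
theorem pow_le_volume_pathSet {T : Set ℝ} {E G : Set (ℝ × (Fin n → ℝ))} (hT : MeasurableSet T)
    (hE : MeasurableSet E) (hG : MeasurableSet G) (hGT : ∀ f ∈ G, f.1 ∈ T) {a : ℝ≥0∞} {b δ : ℝ}
    (hδ0 : 0 ≤ δ) {N : ℕ} (hδ : 4 * δ * N ≤ b) (k : ℕ) :
    ∀ (f : ℝ × (Fin n → ℝ)) (h : Finset ℝ), f ∈ refined E a (ENNReal.ofReal b) G k →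
      h.card + k ≤ N →
      (a * ENNReal.ofReal (b / 2)) ^ k ≤ volume (pathSet T G δ k f h) := by
  induction k with
  | zero =>
    intro f h hf _
    have : pathSet T G δ 0 f h = Set.univ := by
      refine Set.eq_univ_of_forall fun p => ⟨fun i => i.elim0, fun i => i.elim0, ?_⟩
      rw [endpoint_zero]; exact hf
    rw [this]; simp [Measure.volume_pi_eq_dirac (default : Fin 0 → ℝ × ℝ)]
  | succ k ih =>
    intro f h hf hk
    rw [refined_succ] at hf
    set Fk := refined E a (ENNReal.ofReal b) G k with hFk
    have hFm : MeasurableSet Fk := measurableSet_refined hE hG _ _ k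
    set Ek := richPoints E (ENNReal.ofReal b) Fk
    have hEm : MeasurableSet Ek := measurableSet_richPoints hE hFm _
    let sep : Set ℝ := {t | ∀ u ∈ h, δ ≤ |t - u|}
    have hsep : MeasurableSet sep := measurableSet_separated measurable_id _ _
    let D : Set (ℝ × ℝ) := {q | onLine f q.1 ∈ Ek ∧ step f q ∈ Fk ∧ q.2 ∈ sep}
    have honl : Measurable fun s : ℝ => onLine f s :=
      measurable_onLine.comp (measurable_const.prodMk measurable_id)
    have hD : MeasurableSet D := by
      refine .inter ((honl.comp measurable_fst) hEm) (.inter ?_ (measurable_snd hsep))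
      exact (measurable_through.comp ((honl.comp measurable_fst).prodMk measurable_snd)) hFm
    have hDvol : a * ENNReal.ofReal (b / 2) ≤ volume D := by
      rw [Measure.volume_eq_prod, Measure.prod_apply hD]
      calc a * ENNReal.ofReal (b / 2)
          ≤ ∫⁻ _ in onLine f ⁻¹' Ek, ENNReal.ofReal (b / 2) := by
            rw [setLIntegral_const, mul_comm]
            gcongr
            exact hf.2
        _ ≤ ∫⁻ s in onLine f ⁻¹' Ek, volume (Prod.mk s ⁻¹' D) := by
            refine setLIntegral_mono' (honl hEm) fun s hs => ?_
            have h1 : ENNReal.ofReal b ≤ volume (through (onLine f s) ⁻¹' Fk) := hs.2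
            refine (measure_separated (δ := δ) h h1 ?_).trans (measure_mono ?_)
            · refine le_trans ?_ hδ
              gcongr
              exact_mod_cast (by omega : h.card ≤ N)
            · rintro t ⟨ht1, ht2⟩
              exact ⟨hs, ht1, ht2⟩
        _ ≤ _ := setLIntegral_le_lintegral _ _
    rw [volume_fin_cons (measurableSet_pathSet hT hG δ _ f h), pow_succ']
    calc a * ENNReal.ofReal (b / 2) * (a * ENNReal.ofReal (b / 2)) ^ k
        ≤ ∫⁻ _ in D, (a * ENNReal.ofReal (b / 2)) ^ k := by
          rw [setLIntegral_const, mul_comm]; gcongr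
      _ ≤ ∫⁻ q in D, volume {p : Fin k → ℝ × ℝ | Fin.cons q p ∈ pathSet T G δ (k + 1) f h} := by
          refine setLIntegral_mono' hD fun q hq => ?_
          obtain ⟨_, hq2, hq3⟩ := hq
          have hc : (insert q.2 h).card + k ≤ N := by
            have := Finset.card_insert_le q.2 h; omega
          refine (ih _ _ hq2 hc).trans (measure_mono fun p hp => ?_)
          exact cons_mem_pathSet (hGT _ (refined_subset _ _ _ _ _ hq2)) hq3 hp
      _ ≤ _ := setLIntegral_le_lintegral _ _

/-! ### Upper bound for the measure of the paths. -/

theorem lintegral_Ioo_rpow {τ η : ℝ} (hτ : 0 < τ) (hη : 0 < η) :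
    ∫⁻ x : ℝ, (Set.Ioo 0 τ).indicator (fun x => ENNReal.ofReal (x ^ (η - 1))) x =
      ENNReal.ofReal (τ ^ η / η) := by
  have hi : IntervalIntegrable (fun x : ℝ => x ^ (η - 1)) volume 0 τ :=
    intervalIntegral.intervalIntegrable_rpow' (by linarith)
  rw [lintegral_indicator measurableSet_Ioo, ← ofReal_integral_eq_lintegral_ofReal,
    ← integral_Ioc_eq_integral_Ioo, ← intervalIntegral.integral_of_le hτ.le,
    integral_rpow (Or.inl (by linarith))]
  · simp [Real.zero_rpow hη.ne']
  · exact ((intervalIntegrable_iff_integrableOn_Ioc_of_le hτ.le).1 hi).mono_set Set.Ioo_subset_Ioc_self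
  · exact (ae_restrict_iff' measurableSet_Ioo).2 (.of_forall fun x hx => Real.rpow_nonneg hx.1.le _)

/-- The Riesz potential of a set of measure at most `τ`. -/
theorem setLIntegral_abs_rpow_le {T : Set ℝ} {τ η : ℝ} (hτ : 0 < τ)
    (hT : volume T ≤ ENNReal.ofReal τ) (hη0 : 0 < η) (hη1 : η < 1) (t₀ : ℝ) :
    ∫⁻ u in T, ENNReal.ofReal (|u - t₀| ^ (η - 1)) ≤ ENNReal.ofReal ((2 / η + 1) * τ ^ η) := by
  let φ : ℝ → ℝ≥0∞ := (Set.Ioo 0 τ).indicator fun x => ENNReal.ofReal (x ^ (η - 1))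
  have hφ : Measurable φ := by
    refine Measurable.indicator ?_ measurableSet_Ioo
    fun_prop
  -- Within distance τ of t₀ the kernel is integrated over the whole interval; farther away it is at
  -- most τ^{η-1}, and `T` has measure at most τ.
  have hle : ∀ u, ENNReal.ofReal (|u - t₀| ^ (η - 1)) ≤
      φ (u - t₀) + φ (t₀ - u) + ENNReal.ofReal (τ ^ (η - 1)) := by
    intro u
    rcases le_or_gt τ |u - t₀| with h | h
    · refine le_add_left (ENNReal.ofReal_le_ofReal ?_)
      exact Real.rpow_le_rpow_of_nonpos hτ h (by linarith)
    · rcases lt_trichotomy (u - t₀) 0 with h0 | h0 | h0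
      · have hm : t₀ - u ∈ Set.Ioo 0 τ := by
          rw [abs_of_neg h0] at h; constructor <;> linarith
        refine le_add_right (le_add_left ?_)
        simp only [φ, Set.indicator_of_mem hm]
        rw [abs_of_neg h0, neg_sub]
      -- At u = t₀ the real power is 0 by convention, since its exponent is not zero.
      · rw [h0, abs_zero, Real.zero_rpow (by linarith)]; simp
      · have hm : u - t₀ ∈ Set.Ioo 0 τ := by
          rw [abs_of_pos h0] at h; constructor <;> linarith
        refine le_add_right (le_add_right ?_)
        simp only [φ, Set.indicator_of_mem hm]
        rw [abs_of_pos h0]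
  have hτη : τ ^ (η - 1) * τ = τ ^ η := by
    rw [Real.rpow_sub_one hτ.ne']; field_simp
  calc ∫⁻ u in T, ENNReal.ofReal (|u - t₀| ^ (η - 1))
      ≤ ∫⁻ u in T, (φ (u - t₀) + φ (t₀ - u) + ENNReal.ofReal (τ ^ (η - 1))) :=
        lintegral_mono hle
    _ = ∫⁻ u in T, φ (u - t₀) + φ (t₀ - u) + ENNReal.ofReal (τ ^ (η - 1)) := rfl
    _ ≤ (∫⁻ u, φ (u - t₀)) + (∫⁻ u, φ (t₀ - u)) + ENNReal.ofReal (τ ^ (η - 1)) * volume T := by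
        rw [lintegral_add_right _ measurable_const, setLIntegral_const,
          lintegral_add_left (by fun_prop)]
        gcongr <;> exact Measure.restrict_le_self
    _ ≤ ENNReal.ofReal (τ ^ η / η) + ENNReal.ofReal (τ ^ η / η) +
          ENNReal.ofReal (τ ^ (η - 1)) * ENNReal.ofReal τ := by
        rw [lintegral_sub_right_eq_self, lintegral_sub_left_eq_self, lintegral_Ioo_rpow hτ hη0]
        gcongr
    _ = ENNReal.ofReal ((2 / η + 1) * τ ^ η) := by
        rw [← ENNReal.ofReal_mul (by positivity), ← ENNReal.ofReal_add (by positivity)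
          (by positivity), ← ENNReal.ofReal_add (by positivity) (by positivity), hτη]
        congr 1; ring

/-- The number of pairs `i < j` in `Fin n`. -/
def pairCount (n : ℕ) : ℕ := ∑ i : Fin n, (Finset.Ioi i).card

theorem pairCount_eq (n : ℕ) : (pairCount n : ℝ) = n * (n - 1) / 2 := by
  have h : pairCount n * 2 = n * (n - 1) := by
    unfold pairCount
    simp_rw [Fin.card_Ioi]
    rw [Fin.sum_univ_eq_sum_range (fun i => n - 1 - i) n, Finset.sum_range_reflect (fun i => i),
      Finset.sum_range_id_mul_two]
  rcases n with _ | m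
  · simp [pairCount]
  · have h' : ((pairCount (m + 1) * 2 : ℕ) : ℝ) = ((m + 1) * m : ℕ) := by rw [h]; simp
    push_cast at h' ⊢
    linarith

/-- The factors |t i - t j| are bounded below by δ. Each factor |t i - t₀| is split as |t i - t₀|^η
|t i - t₀|^{1-η} and only the first part is replaced by a power of δ; the rest stays integrable
after inversion. Using δ for the whole factor would lose too much for θ near 1. -/
theorem le_abs_det_diffMatrix {δ η : ℝ} (hδ : 0 < δ) (hη0 : 0 < η) {t₀ : ℝ}
    {t : Fin n → ℝ} (h0 : ∀ i, δ ≤ |t i - t₀|) (h : ∀ i j, i ≠ j → δ ≤ |t i - t j|) :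
    δ ^ pairCount n * (δ ^ η) ^ n * (∏ i, |t i - t₀| ^ (η - 1))⁻¹ ≤
      |(diffMatrix (Fin.cons t₀ t : Fin (n + 1) → ℝ)).det| := by
  rw [det_diffMatrix, Fin.prod_univ_succ, Fin.prod_Ioi_zero]
  simp_rw [Fin.prod_Ioi_succ, Fin.cons_zero, Fin.cons_succ, abs_mul, Finset.abs_prod]
  rw [mul_comm, ← mul_assoc, mul_comm]
  rw [mul_comm (∏ i, _)]
  have h1 : δ ^ pairCount n ≤ ∏ i : Fin n, ∏ j ∈ Finset.Ioi i, |t j - t i| := by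
    rw [pairCount, ← Finset.prod_pow_eq_pow_sum]
    refine Finset.prod_le_prod (fun _ _ => by positivity) fun i _ => ?_
    rw [← Finset.prod_const]
    refine Finset.prod_le_prod (fun _ _ => hδ.le) fun j hj => h j i (Finset.mem_Ioi.1 hj).ne'
  have h2 : (δ ^ η) ^ n * (∏ i, |t i - t₀| ^ (η - 1))⁻¹ ≤ ∏ i : Fin n, |t i - t₀| := by
    rw [← Finset.prod_inv_distrib, ← Fin.prod_const, ← Finset.prod_mul_distrib]
    refine Finset.prod_le_prod (fun _ _ => by positivity) fun i _ => ?_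
    have hp : 0 < |t i - t₀| := hδ.trans_le (h0 i)
    calc δ ^ η * (|t i - t₀| ^ (η - 1))⁻¹ ≤ |t i - t₀| ^ η * (|t i - t₀| ^ (η - 1))⁻¹ := by
          gcongr; exact h0 i
      _ = |t i - t₀| := by
          rw [Real.rpow_sub_one hp.ne']
          have := Real.rpow_pos_of_pos hp η
          field_simp
  calc _ = δ ^ pairCount n * ((δ ^ η) ^ n * (∏ i, |t i - t₀| ^ (η - 1))⁻¹) := by ring
    _ ≤ _ := mul_le_mul h1 h2 (by positivity) (by positivity)

theorem volume_pathSet_le {T : Set ℝ} {G : Set (ℝ × (Fin n → ℝ))} (hT : MeasurableSet T)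
    (hG : MeasurableSet G) {A δ τ η : ℝ} (hA : ∀ t, volume (Prod.mk t ⁻¹' G) ≤ ENNReal.ofReal A)
    (hA0 : 0 ≤ A) (hδ : 0 < δ) (hτ : 0 < τ) (hTτ : volume T ≤ ENNReal.ofReal τ) (hη0 : 0 < η)
    (hη1 : η < 1) (f : ℝ × (Fin n → ℝ)) :
    volume (pathSet T G δ n f {f.1}) ≤
      ENNReal.ofReal (A * (δ ^ pairCount n * (δ ^ η) ^ n)⁻¹ * ((2 / η + 1) * τ ^ η) ^ n) := by
  let g : ℝ → ℝ≥0∞ := T.indicator fun u => ENNReal.ofReal (|u - f.1| ^ (η - 1))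
  have hg : Measurable g := by
    refine Measurable.indicator ?_ hT
    simp_rw [← Real.norm_eq_abs]; fun_prop
  set K : ℝ := (δ ^ pairCount n * (δ ^ η) ^ n)⁻¹ with hK
  have hK0 : 0 ≤ K := by positivity
  have hP := measurableSet_pathSet hT hG δ n f {f.1}
  have hmp := (volume_measurePreserving_arrowProdEquivProdArrow ℝ ℝ (Fin n)).symm
  -- Point parameters and line parameters are separated, so that the inner integral runs over the
  -- point parameters.
  rw [← hmp.measure_preimage hP.nullMeasurableSet, Measure.volume_eq_prod,
    Measure.prod_apply_symm (hmp.measurable hP)]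
  have key : ∀ t : Fin n → ℝ, volume ((fun s : Fin n → ℝ => (s, t)) ⁻¹'
      ((MeasurableEquiv.arrowProdEquivProdArrow ℝ ℝ (Fin n)).symm ⁻¹'
        pathSet T G δ n f {f.1})) ≤ ENNReal.ofReal (A * K) * ∏ i, g (t i) := by
    intro t
    by_cases ht : (∀ i, t i ∈ T ∧ δ ≤ |t i - f.1|) ∧ ∀ i j, i ≠ j → δ ≤ |t i - t j|
    · obtain ⟨ht1, ht2⟩ := ht
      have hdet := le_abs_det_diffMatrix hδ hη0 (fun i => (ht1 i).2) ht2
      set v : Fin (n + 1) → ℝ := Fin.cons f.1 t with hv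
      have hprod : 0 < ∏ i, |t i - f.1| ^ (η - 1) :=
        Finset.prod_pos fun i _ => Real.rpow_pos_of_pos (hδ.trans_le (ht1 i).2) _
      have hdet0 : 0 < |(diffMatrix v).det| := lt_of_lt_of_le (by positivity) hdet
      have hsub : (fun s : Fin n → ℝ => (s, t)) ⁻¹'
          ((MeasurableEquiv.arrowProdEquivProdArrow ℝ ℝ (Fin n)).symm ⁻¹'
            pathSet T G δ n f {f.1}) ⊆
          {s : Fin n → ℝ | f.2 + ∑ i, s i • (curve n (v i.castSucc) - curve n (v i.succ)) ∈
            Prod.mk (v (Fin.last n)) ⁻¹' G} := fun s hs => hs.2.2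
      refine (measure_mono hsub).trans ?_
      rw [volume_endpoint_fibre v (abs_pos.1 hdet0)]
      have hgp : ∏ i, g (t i) = ENNReal.ofReal (∏ i, |t i - f.1| ^ (η - 1)) := by
        rw [ENNReal.ofReal_prod_of_nonneg fun i _ => by positivity]
        exact Finset.prod_congr rfl fun i _ => Set.indicator_of_mem (ht1 i).1 _
      calc _ ≤ ENNReal.ofReal |(diffMatrix v).det|⁻¹ * ENNReal.ofReal A := by gcongr; exact hA _
        _ ≤ ENNReal.ofReal (K * ∏ i, |t i - f.1| ^ (η - 1)) * ENNReal.ofReal A := by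
          gcongr
          rw [hK, ← inv_inv (∏ i, |t i - f.1| ^ (η - 1)), ← mul_inv]
          exact inv_anti₀ (by positivity) hdet
        _ = _ := by
          rw [hgp, ← ENNReal.ofReal_mul (by positivity), ← ENNReal.ofReal_mul (by positivity)]
          congr 1; ring
    · have : (fun s : Fin n → ℝ => (s, t)) ⁻¹'
          ((MeasurableEquiv.arrowProdEquivProdArrow ℝ ℝ (Fin n)).symm ⁻¹'
            pathSet T G δ n f {f.1}) = ∅ := by
        refine Set.eq_empty_of_forall_notMem fun s hs => ht ⟨fun i => ⟨(hs.1 i).1, ?_⟩, hs.2.1⟩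
        exact (hs.1 i).2 f.1 (Finset.mem_singleton_self _)
      rw [this]; simp
  calc _ ≤ ∫⁻ t : Fin n → ℝ, ENNReal.ofReal (A * K) * ∏ i, g (t i) := lintegral_mono key
    _ = ENNReal.ofReal (A * K) * (∫⁻ u, g u) ^ n := by
      rw [lintegral_const_mul _ (by fun_prop), lintegral_prod_pow hg]
    _ ≤ ENNReal.ofReal (A * K) * ENNReal.ofReal ((2 / η + 1) * τ ^ η) ^ n := by
      gcongr
      rw [lintegral_indicator hT]
      exact setLIntegral_abs_rpow_le hτ hTτ hη0 hη1 _
    _ = _ := by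
      rw [← ENNReal.ofReal_pow (by positivity), ← ENNReal.ofReal_mul (by positivity)]

/-! ### Consequences of counting incidences and paths. -/

theorem mul_volume_le_setLIntegral_lineMeasure {E G : Set (ℝ × (Fin n → ℝ))}
    (hG : MeasurableSet G) {a : ℝ≥0∞} (h : ∀ f ∈ G, a ≤ lineMeasure E f) :
    a * volume G ≤ ∫⁻ f in G, lineMeasure E f := by
  rw [← setLIntegral_const]
  exact setLIntegral_mono' hG h

/-- The lines of `G` through a given point have parameters in `T`, so each pencil has measure at
most that of `T`. -/
theorem mul_volume_le_volume_mul {E G : Set (ℝ × (Fin n → ℝ))} {T : Set ℝ}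
    (hE : MeasurableSet E) (hG : MeasurableSet G) (hGT : ∀ f ∈ G, f.1 ∈ T) {a : ℝ≥0∞}
    (h : ∀ f ∈ G, a ≤ lineMeasure E f) : a * volume G ≤ volume T * volume E := by
  refine (mul_volume_le_setLIntegral_lineMeasure hG h).trans ?_
  rw [setLIntegral_lineMeasure_eq hE hG, ← setLIntegral_const]
  exact lintegral_mono fun z => measure_mono fun t ht => hGT _ ht

theorem path_count_le (hn : 0 < n) {E G : Set (ℝ × (Fin n → ℝ))} {T : Set ℝ}
    (hE : MeasurableSet E) (hG : MeasurableSet G) (hT : MeasurableSet T)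
    (hGT : ∀ f ∈ G, f.1 ∈ T) {α e g A τ η : ℝ} (hα : 0 < α) (he : 0 < e) (hg : 0 < g)
    (hA : 0 < A) (hτ : 0 < τ) (hη0 : 0 < η) (hη1 : η < 1) (hEe : volume E = ENNReal.ofReal e)
    (hGg : volume G = ENNReal.ofReal g) (hTτ : volume T ≤ ENNReal.ofReal τ)
    (hGA : ∀ t, volume (Prod.mk t ⁻¹' G) ≤ ENNReal.ofReal A)
    (h : ∀ f ∈ G, ENNReal.ofReal α ≤ lineMeasure E f) {b δ : ℝ} (hb : b = α * g / (4 * n * e))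
    (hδ : δ = b / (4 * (n + 1))) :
    (α / (4 * n) * (b / 2)) ^ n ≤
      A * (δ ^ pairCount n * (δ ^ η) ^ n)⁻¹ * ((2 / η + 1) * τ ^ η) ^ n := by
  have hn' : (0 : ℝ) < n := by exact_mod_cast hn
  have hb0 : 0 < b := by rw [hb]; positivity
  have hδ0 : 0 < δ := by rw [hδ]; positivity
  -- One refinement loses at most b e + (α/(4n)) g = α g/(2n) incidences, so n of them lose at most
  -- half of the α g available.
  obtain ⟨f, hf⟩ := refined_nonempty hE hG (ENNReal.ofReal (α / (4 * n))) (ENNReal.ofReal b) n (by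
    refine lt_of_lt_of_le ?_ (mul_volume_le_setLIntegral_lineMeasure hG h)
    rw [hEe, hGg, ← ENNReal.ofReal_mul hb0.le, ← ENNReal.ofReal_mul (by positivity),
      ← ENNReal.ofReal_add (by positivity) (by positivity), ← ENNReal.ofReal_natCast,
      ← ENNReal.ofReal_mul (by positivity), ← ENNReal.ofReal_mul hα.le,
      ENNReal.ofReal_lt_ofReal_iff (by positivity)]
    have : n * (b * e + α / (4 * n) * g) = α * g / 2 := by
      rw [hb]; field_simp; ring
    rw [this]
    exact half_lt_self (by positivity))
  have h1 := pow_le_volume_pathSet (a := ENNReal.ofReal (α / (4 * n))) (b := b) hT hE hG hGT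
    -- The n parameters along the path and the parameter of the initial line are n + 1 in all.
    hδ0.le (N := n + 1) (by rw [hδ]; push_cast; exact (by field_simp : _ = b).le) n f {f.1} hf
    (by simp [add_comm])
  have h2 := h1.trans (volume_pathSet_le hT hG hGA hA.le hδ0 hτ hTτ hη0 hη1 f)
  rw [← ENNReal.ofReal_mul (by positivity), ← ENNReal.ofReal_pow (by positivity)] at h2
  exact (ENNReal.ofReal_le_ofReal_iff (by positivity)).1 h2

theorem log_path_count_le (hn : 0 < n) {α b δ A τ η : ℝ} (hα : 0 < α) (hb : 0 < b) (hδ : 0 < δ)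
    (hA : 0 < A) (hτ : 0 < τ) (hη : 0 < η)
    (h : (α / (4 * n) * (b / 2)) ^ n ≤
      A * (δ ^ pairCount n * (δ ^ η) ^ n)⁻¹ * ((2 / η + 1) * τ ^ η) ^ n) :
    n * (Real.log α - Real.log (4 * n) + Real.log b - Real.log 2) +
      (n * (n - 1) / 2 + n * η) * Real.log δ ≤
      Real.log A + n * (Real.log (2 / η + 1) + η * Real.log τ) := by
  have hn' : (0 : ℝ) < n := by exact_mod_cast hn
  have hδη := Real.rpow_pos_of_pos hδ η
  have hτη := Real.rpow_pos_of_pos hτ η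
  have hl := Real.log_le_log (by positivity) h
  rw [Real.log_pow, Real.log_mul (by positivity) (by positivity), Real.log_div hα.ne'
    (by positivity), Real.log_div hb.ne' (by positivity), Real.log_mul (by positivity)
    (by positivity), Real.log_mul (by positivity) (by positivity),
    Real.log_mul (by positivity) (by positivity), Real.log_inv,
    Real.log_mul (by positivity) (by positivity), Real.log_pow, Real.log_pow, Real.log_pow,
    Real.log_rpow hδ, Real.log_mul (by positivity) (by positivity), Real.log_rpow hτ,
    pairCount_eq] at hl
  rw [Real.log_mul four_ne_zero hn'.ne']
  linarith

/-! ### Regularisation of the given sets. -/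

theorem fibreNorm_chi_rpow {d : ℕ} {F : Set (Space d)} (hF : MeasurableSet F) {r : ℝ}
    (hr : 0 < r) (t : ℝ) : fibreNorm r (chi F) t = volume (Prod.mk t ⁻¹' F) ^ (1 / r) := by
  have hm : MeasurableSet (Prod.mk t ⁻¹' F) := measurable_prodMk_left hF
  unfold fibreNorm
  have : (fun y : Fin (d - 1) → ℝ => chi F (t, y)) =
      (Prod.mk t ⁻¹' F).indicator fun _ => (1 : ℝ≥0∞) := rfl
  rw [this, eLpNorm_indicator_const hm (by simpa using hr) ENNReal.ofReal_ne_top,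
    ENNReal.toReal_ofReal hr.le]
  simp

theorem fibreNorm_congr {d : ℕ} {F F₁ : Set (Space d)} (h : F =ᵐ[volume] F₁) (r : ℝ) :
    ∀ᵐ t, fibreNorm r (chi F) t = fibreNorm r (chi F₁) t := by
  have h1 := Measure.ae_ae_of_ae_prod (μ := (volume : Measure ℝ))
    (ν := (volume : Measure (Fin (d - 1) → ℝ))) h
  filter_upwards [h1] with t ht
  refine eLpNorm_congr_ae ?_
  filter_upwards [ht] with y hy
  have : (t, y) ∈ F ↔ (t, y) ∈ F₁ := iff_of_eq hy
  by_cases h' : (t, y) ∈ F₁ <;> simp [chi, Set.indicator, this, h']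

/-- Replaces `F'` by a measurable set of lines over a measurable parameter set, with control of
every fibre instead of almost every one. The last bound combines ‖χ_F‖ ≥ (mA)^{1/r} τ^{1/q} with |F|
≤ MAτ. -/
theorem exists_regular_part {d : ℕ} {r q m M A γ : ℝ} (hr : 0 < r) (hq : 0 < q) (hm : 0 < m)
    (hM : 0 < M) (hA : 0 < A) (hγ : 0 < γ) {F F' : Set (Space d)} {T : Set ℝ}
    (hF : NullMeasurableSet F volume) (hF' : NullMeasurableSet F' volume) (hF0 : 0 < volume F)
    (hFtop : volume F < ∞) (hcomp : FibreComparable m M r A T F) (hsub : F' ⊆ F)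
    (hlarge : ENNReal.ofReal γ * volume F ≤ volume F') :
    ∃ (G : Set (Space d)) (S : Set ℝ) (τ g : ℝ), MeasurableSet G ∧ MeasurableSet S ∧ 0 < τ ∧
      0 < g ∧ volume S = ENNReal.ofReal τ ∧ volume G = ENNReal.ofReal g ∧
      γ * (m * A * τ) ≤ g ∧ (∀ f ∈ G, f.1 ∈ S) ∧
      (∀ t, volume (Prod.mk t ⁻¹' G) ≤ ENNReal.ofReal (M * A)) ∧ (∀ᵐ z, z ∈ G → z ∈ F') ∧
      ENNReal.ofReal ((m * A) ^ (1 / r) * τ ^ (1 / q) / (M * A * τ)) ≤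
        mixedNorm q r (chi F) * (volume F)⁻¹ := by
  obtain ⟨F₁, -, hF₁, hFF₁⟩ := hF.exists_measurable_superset_ae_eq
  obtain ⟨F₂, -, hF₂, hFF₂⟩ := hF'.exists_measurable_superset_ae_eq
  let v : ℝ → ℝ≥0∞ := fun t => volume (Prod.mk t ⁻¹' F₁)
  have hv : Measurable v := measurable_measure_prodMk_left hF₁
  -- `T` need not be measurable. The set `S` of parameters whose fibre has the right size replaces
  -- it, and almost every other fibre is null.
  let S : Set ℝ := {t | ENNReal.ofReal (m * A) ≤ v t} ∩ {t | v t ≤ ENNReal.ofReal (M * A)}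
  have hS : MeasurableSet S :=
    (measurableSet_le measurable_const hv).inter (measurableSet_le hv measurable_const)
  have hvF : volume F = ∫⁻ t, v t := by
    rw [← measure_congr hFF₁, Measure.volume_eq_prod, Measure.prod_apply hF₁]
  have hnorm : ∀ᵐ t, fibreNorm r (chi F) t = v t ^ (1 / r) := by
    filter_upwards [fibreNorm_congr hFF₁.symm r] with t ht
    rw [ht, fibreNorm_chi_rpow hF₁ hr]
  have hdich : ∀ᵐ t, t ∈ S ∨ v t = 0 := by
    filter_upwards [hcomp, hnorm] with t ht hn
    rw [hn, ← ENNReal.rpow_mul, one_div_mul_cancel hr.ne', ENNReal.rpow_one] at ht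
    by_cases hT : t ∈ T
    · left; simpa [hT, S] using ht
    · right; simpa [hT] using ht.2
  have hle : volume F ≤ ENNReal.ofReal (M * A) * volume S := by
    rw [hvF, ← setLIntegral_const, ← lintegral_indicator hS]
    refine lintegral_mono_ae ?_
    filter_upwards [hdich] with t ht
    by_cases hT : t ∈ S
    · simpa [hT] using hT.2
    · simp [ht.resolve_left hT]
  have hge : ENNReal.ofReal (m * A) * volume S ≤ volume F := by
    rw [hvF, ← setLIntegral_const]
    exact (setLIntegral_mono' hS fun t ht => ht.1).trans (setLIntegral_le_lintegral _ _)
  have hmA : ENNReal.ofReal (m * A) ≠ 0 := by simpa using mul_pos hm hA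
  have hStop : volume S ≠ ∞ := by
    intro h
    rw [h, ENNReal.mul_top hmA] at hge
    exact hFtop.not_ge hge
  have hS0 : volume S ≠ 0 := by
    intro h
    rw [h, mul_zero] at hle
    exact hF0.not_ge hle
  set τ := (volume S).toReal with hτdef
  have hτ : 0 < τ := ENNReal.toReal_pos hS0 hStop
  have hSτ : volume S = ENNReal.ofReal τ := (ENNReal.ofReal_toReal hStop).symm
  let G : Set (Space d) := (F₂ ∩ F₁) ∩ Prod.fst ⁻¹' S
  have hGm : MeasurableSet G := (hF₂.inter hF₁).inter (measurable_fst hS)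
  have hFS : volume (F₁ ∩ Prod.fst ⁻¹' Sᶜ) = 0 := by
    have hmm : MeasurableSet (F₁ ∩ Prod.fst ⁻¹' Sᶜ) := hF₁.inter (measurable_fst hS.compl)
    rw [Measure.volume_eq_prod, Measure.measure_prod_null hmm]
    filter_upwards [hdich] with t ht
    by_cases hT : t ∈ S
    · have : Prod.mk t ⁻¹' (F₁ ∩ Prod.fst ⁻¹' Sᶜ) = ∅ :=
        Set.eq_empty_of_forall_notMem fun y hy => hy.2 hT
      rw [this]; simp
    · exact measure_mono_null (fun y hy => hy.1) (ht.resolve_left hT)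
  have hGF' : G =ᵐ[volume] F' := by
    have h1 : ∀ᵐ z, z ∉ F₁ ∩ Prod.fst ⁻¹' Sᶜ := measure_eq_zero_iff_ae_notMem.1 hFS
    filter_upwards [h1, hFF₁, hFF₂] with z hz hz1 hz2
    have e1 : (z ∈ F₁) = (z ∈ F) := hz1
    have e2 : (z ∈ F₂) = (z ∈ F') := hz2
    refine propext ⟨fun h => e2.mp h.1.1, fun h => ?_⟩
    have hzF : z ∈ F₁ := e1.mpr (hsub h)
    exact ⟨⟨e2.mpr h, hzF⟩, by_contra fun hn => hz ⟨hzF, hn⟩⟩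
  have hGvol : volume G = volume F' := measure_congr hGF'
  have hGtop : volume G ≠ ∞ := by
    rw [hGvol]; exact ((measure_mono hsub).trans_lt hFtop).ne
  have hGlow : ENNReal.ofReal (γ * (m * A * τ)) ≤ volume G := by
    rw [hGvol, ENNReal.ofReal_mul hγ.le, ENNReal.ofReal_mul (by positivity), ← hSτ]
    exact le_trans (by gcongr) hlarge
  have hglow : γ * (m * A * τ) ≤ (volume G).toReal := (ENNReal.ofReal_le_iff_le_toReal hGtop).1 hGlow
  refine ⟨G, S, τ, (volume G).toReal, hGm, hS, hτ, lt_of_lt_of_le (by positivity) hglow, hSτ,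
    (ENNReal.ofReal_toReal hGtop).symm, hglow, fun f hf => hf.2, fun t => ?_, ?_, ?_⟩
  · by_cases hT : t ∈ S
    · exact (measure_mono fun y hy => hy.1.2).trans hT.2
    · have : Prod.mk t ⁻¹' G = ∅ := Set.eq_empty_of_forall_notMem fun y hy => hT hy.2
      rw [this]; simp
  · filter_upwards [hGF'] with z hz h
    have : (z ∈ G) = (z ∈ F') := hz
    exact this.mp h
  · have h1 : ENNReal.ofReal ((m * A) ^ (1 / r) * τ ^ (1 / q)) ≤ mixedNorm q r (chi F) := by
      have : eLpNorm (S.indicator fun _ => ENNReal.ofReal ((m * A) ^ (1 / r)))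
          (ENNReal.ofReal q) volume ≤ mixedNorm q r (chi F) := by
        refine eLpNorm_mono_enorm_ae ?_
        filter_upwards [hnorm] with t ht
        by_cases hT : t ∈ S
        · simp only [Set.indicator_of_mem hT, ht, enorm_eq_self]
          rw [← ENNReal.ofReal_rpow_of_pos (by positivity)]
          gcongr
          exact hT.1
        · simp [hT]
      rw [eLpNorm_indicator_const hS (by simpa using hq) ENNReal.ofReal_ne_top,
        ENNReal.toReal_ofReal hq.le, hSτ, enorm_eq_self, ENNReal.ofReal_rpow_of_pos hτ,
        ← ENNReal.ofReal_mul (by positivity)] at this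
      exact this
    rw [ENNReal.ofReal_div_of_pos (by positivity), ENNReal.div_eq_inv_mul, mul_comm]
    gcongr
    rw [ENNReal.ofReal_mul (by positivity), ← hSτ]
    exact hle

/-- Passing to a measurable representative changes the X-ray transform only on a null set. -/
theorem ae_xray_eq_lineMeasure {d : ℕ} {E E₁ : Set (Space d)} (hE₁ : MeasurableSet E₁)
    (h : E =ᵐ[volume] E₁) : ∀ᵐ z, xray d (chi E) z = lineMeasure E₁ z := by
  have hN : volume {z : Space d | ¬ ((z ∈ E) = (z ∈ E₁))} = 0 := h
  filter_upwards [ae_lineMeasure_eq_zero hN] with z hz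
  have hm : MeasurableSet (onLine z ⁻¹' E₁) :=
    (measurable_onLine.comp (measurable_const.prodMk measurable_id)) hE₁
  rw [lineMeasure, ← lintegral_indicator_one hm]
  refine lintegral_congr_ae ?_
  filter_upwards [measure_eq_zero_iff_ae_notMem.1 hz] with s hs
  have hs' : onLine z s ∈ E ↔ onLine z s ∈ E₁ := iff_of_eq (not_not.1 hs)
  change (E.indicator (fun _ => (1 : ℝ≥0∞))) (onLine z s) = _
  by_cases h' : onLine z s ∈ E₁ <;> simp [Set.indicator, hs', h']

/-! ### Exponents and the critical size. -/

theorem one_div_conjExponent_inv {w : ℝ} (hw : w ≠ 0) : 1 / Real.conjExponent w⁻¹ = 1 - w := by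
  unfold Real.conjExponent
  rw [one_div_div]
  field_simp

/-- This and the two dual exponents below are written in terms of u = 2θ/(d+2), so that the powers
of A, τ and e in `level` combine into a power of the ratio to the critical size. -/
theorem one_div_pExp (d : ℕ) (θ : ℝ) : 1 / pExp d θ = 1 - 2 * θ / (d + 2) := by
  have : (d : ℝ) + 2 ≠ 0 := by positivity
  rw [pExp, one_div, inv_inv]
  field_simp
  ring

theorem one_div_qDual {d : ℕ} (hd : 0 < d) {θ : ℝ} (hθ : 0 < θ) :
    1 / qDual d θ = 1 - 2 * θ / (d + 2) * d / 2 := by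
  have h0 : (0 : ℝ) < d := by exact_mod_cast hd
  rw [qDual, qExp, one_div_conjExponent_inv (by positivity)]
  field_simp

theorem one_div_rDual {d : ℕ} (hd : 3 ≤ d) {θ : ℝ} (hθ0 : 0 < θ) (hθ1 : θ < 1) :
    1 / rDual d θ = 2 * θ / (d + 2) * (d / (d - 1)) := by
  have h0 : (3 : ℝ) ≤ d := by exact_mod_cast hd
  have h1 : (d : ℝ) - 1 ≠ 0 := by linarith
  have h2 : (d : ℝ) + 2 ≠ 0 := by linarith
  have h3 : (d : ℝ) ^ 2 + d - 2 = (d + 2) * (d - 1) := by ring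
  have h4 : 0 < 1 - θ + θ * ((d : ℝ) ^ 2 - d - 2) / ((d : ℝ) ^ 2 + d - 2) := by
    have : (0 : ℝ) ≤ θ * ((d : ℝ) ^ 2 - d - 2) / ((d : ℝ) ^ 2 + d - 2) :=
      div_nonneg (mul_nonneg hθ0.le (by nlinarith)) (by nlinarith)
    linarith
  rw [rDual, rExp, one_div_conjExponent_inv h4.ne', h3]
  field_simp
  ring

/-- The logarithm of the ratio of `e` to the critical size `A^{d/(d-1)} τ^{-d/2}`. -/
def logRatio (d : ℕ) (A τ e : ℝ) : ℝ :=
  Real.log e - d / (d - 1) * Real.log A + d / 2 * Real.log τ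

/-- The natural lower bound for the X-ray transform of a set of measure `e`. -/
def level (d : ℕ) (θ ε m M A τ e : ℝ) : ℝ :=
  ε * e ^ (1 / pExp d θ) *
    ((m * A) ^ (1 / rDual d θ) * τ ^ (1 / qDual d θ) / (M * A * τ))

theorem level_pos {d : ℕ} {θ ε m M A τ e : ℝ} (hε : 0 < ε) (hm : 0 < m) (hM : 0 < M) (hA : 0 < A)
    (hτ : 0 < τ) (he : 0 < e) : 0 < level d θ ε m M A τ e := by
  unfold level; positivity

/-- Up to a constant, `level` is ε (e/A) ρ^{-u}, with ρ the exponential of `logRatio`. -/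
theorem log_level {d : ℕ} (hd : 3 ≤ d) {θ ε m M A τ e : ℝ} (hθ0 : 0 < θ) (hθ1 : θ < 1)
    (hε : 0 < ε) (hm : 0 < m) (hM : 0 < M) (hA : 0 < A) (hτ : 0 < τ) (he : 0 < e) :
    Real.log (level d θ ε m M A τ e) = Real.log ε + Real.log e - Real.log A -
      2 * θ / (d + 2) * logRatio d A τ e +
      (2 * θ / (d + 2) * (d / (d - 1)) * Real.log m - Real.log M) := by
  have h1 := Real.rpow_pos_of_pos he (1 / pExp d θ)
  have h2 := Real.rpow_pos_of_pos (mul_pos hm hA) (1 / rDual d θ)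
  have h3 := Real.rpow_pos_of_pos hτ (1 / qDual d θ)
  rw [level, Real.log_mul (by positivity) (by positivity), Real.log_mul hε.ne' h1.ne',
    Real.log_div (by positivity) (by positivity), Real.log_mul h2.ne' h3.ne',
    Real.log_mul (by positivity) hτ.ne', Real.log_mul hM.ne' hA.ne', Real.log_rpow he,
    Real.log_rpow (mul_pos hm hA), Real.log_rpow hτ, Real.log_mul hm.ne' hA.ne', one_div_pExp,
    one_div_qDual (by omega) hθ0, one_div_rDual hd hθ0 hθ1, logRatio]
  ring

/-- Here N = d-1, x = log e, y = log β, R is `logRatio`, and the names beginning with l are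
logarithms. The N-th root of the path inequality reads α β^{P-1} ≲ A^{1/N} τ^η, since δ is a
multiple of β; inserting the lower bound for g and the formula for α leaves only powers of ε and ρ.
-/
theorem upper_numerics {N D P η u b lε lA lτ x R lα lg y la lm lM l4 l2 l5 lC c₀ : ℝ} (hN : 0 < N)
    (hD : D = 1 + 1 / N) (hP : P = (N + 3) / 2 + η) (hη : 0 < η)
    (hR : R = x - D * lA + (N + 1) / 2 * lτ) (hα : lα = lε + x - lA - u * R + c₀)
    (hg : la + b * lε + (lm + lA + lτ) ≤ lg) (hy : y = lα + lg - x - l4)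
    (h : N * (lα - l4 + y - l2) + (N * (N - 1) / 2 + N * η) * (y - l5) ≤
      (lM + lA) + N * (lC + η * lτ)) :
    (1 - P * u) * R ≤ (lM / N + l4 + l2 + lC + ((N - 1) / 2 + η) * l5 - P * c₀ -
      (P - 1) * (la + lm - l4)) - (P + (P - 1) * b) * lε := by
  have h1 : lα - l4 + y - l2 + ((N - 1) / 2 + η) * (y - l5) - lC - η * lτ ≤ lM / N + lA / N := by
    rw [← add_div, le_div_iff₀ hN]
    linarith
  have h2 : (P - 1) * (lα + (la + b * lε + (lm + lA + lτ)) - x - l4) ≤ (P - 1) * y := by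
    refine mul_le_mul_of_nonneg_left (by linarith) (by rw [hP]; linarith)
  have h3 : lα + (P - 1) * (lα + (la + b * lε + (lm + lA + lτ)) - x - l4) ≤
      lM / N + lA / N + l4 + l2 + lC + ((N - 1) / 2 + η) * l5 + η * lτ := by
    have : (P - 1) * y = y + ((N - 1) / 2 + η) * y := by rw [hP]; ring
    linarith
  -- The powers of A, τ and e assemble into exactly one factor ρ, besides the factor ρ^{-Pu} coming
  -- from α.
  have h4 : lα + (P - 1) * (lα + (la + b * lε + (lm + lA + lτ)) - x - l4) - lA / N - η * lτ =
      P * (lε + c₀) + (P - 1) * (b * lε + la + lm - l4) + R - P * u * R := by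
    have : R = x - (1 + 1 / N) * lA + (P - 1 - η) * lτ := by rw [hR, hD, hP]; ring
    rw [hα]
    linear_combination (-1 : ℝ) * this
  linarith

theorem log_volume_bounds {d : ℕ} (hd : 3 ≤ d) {θ a b m M : ℝ} (hθ0 : 0 < θ) (hθ1 : θ < 1)
    (ha : 0 < a) (hb : 0 < b) (hm : 0 < m) (hM : 0 < M) :
    ∃ c k : ℝ, 0 < k ∧ ∃ c' k' : ℝ, 0 < k' ∧ ∀ (ε A τ g e : ℝ) (E G : Set (Space d)) (S : Set ℝ),
      0 < ε → 0 < A → 0 < τ → 0 < e → 0 < g → MeasurableSet E → MeasurableSet G →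
      MeasurableSet S → volume E = ENNReal.ofReal e → volume G = ENNReal.ofReal g →
      volume S = ENNReal.ofReal τ → a * ε ^ b * (m * A * τ) ≤ g → (∀ f ∈ G, f.1 ∈ S) →
      (∀ t, volume (Prod.mk t ⁻¹' G) ≤ ENNReal.ofReal (M * A)) →
      (∀ f ∈ G, ENNReal.ofReal (level d θ ε m M A τ e) ≤ lineMeasure E f) →
      c + k * Real.log ε ≤ logRatio d A τ e ∧ logRatio d A τ e ≤ c' - k' * Real.log ε := by
  have hd' : (3 : ℝ) ≤ d := by exact_mod_cast hd
  obtain ⟨n, hn⟩ : ∃ n, n = d - 1 := ⟨_, rfl⟩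
  have hn0 : 0 < n := by omega
  have hnd : (d : ℝ) = n + 1 := by
    have : d = n + 1 := by omega
    exact_mod_cast this
  have hn0' : (0 : ℝ) < n := by exact_mod_cast hn0
  set u : ℝ := 2 * θ / (d + 2) with hu
  have hu0 : 0 < u := by positivity
  have hu1 : u < 1 := by
    rw [hu, div_lt_one (by positivity)]; linarith
  -- Any η with ηu < 1 - θ would do; half of 1 - θ is enough because u < 1.
  set η : ℝ := (1 - θ) / 2 with hη
  have hη0 : 0 < η := by rw [hη]; linarith
  have hη1 : η < 1 := by rw [hη]; linarith
  set P : ℝ := ((n : ℝ) + 3) / 2 + η with hP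
  have hP1 : 1 < P := by rw [hP]; linarith
  have hPu : 0 < 1 - P * u := by
    have h1 : P * u = θ + η * u := by
      rw [hP, hu, hnd]; field_simp; ring
    have h2 : η * u < η := by nlinarith
    rw [h1]; linarith
  set c₀ : ℝ := u * (d / (d - 1)) * Real.log m - Real.log M with hc₀
  refine ⟨(Real.log a + Real.log m + c₀) / u, (1 + b) / u, by positivity,
    (Real.log M / n + Real.log (4 * n) + Real.log 2 + Real.log (2 / η + 1) +
      (((n : ℝ) - 1) / 2 + η) * Real.log (4 * (n + 1)) - P * c₀ -
      (P - 1) * (Real.log a + Real.log m - Real.log (4 * n))) / (1 - P * u),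
    (P + (P - 1) * b) / (1 - P * u),
    div_pos (add_pos (by linarith) (mul_pos (by linarith) hb)) hPu, ?_⟩
  intro ε A τ g e E G S hε hA hτ he hg hE hG hS hEe hGg hSτ hgl hGS hGA hlev
  have hlα := log_level hd hθ0 hθ1 hε hm hM hA hτ he
  have hα := level_pos (d := d) (θ := θ) hε hm hM hA hτ he
  set α := level d θ ε m M A τ e
  rw [← hu, ← hc₀] at hlα
  have hεb := Real.rpow_pos_of_pos hε b
  have hlg : Real.log a + b * Real.log ε + (Real.log m + Real.log A + Real.log τ) ≤
      Real.log g := by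
    have := Real.log_le_log (by positivity) hgl
    rwa [Real.log_mul (by positivity) (by positivity), Real.log_mul ha.ne' hεb.ne',
      Real.log_rpow hε, Real.log_mul (by positivity) hτ.ne', Real.log_mul hm.ne' hA.ne'] at this
  constructor
  · have h1 := mul_volume_le_volume_mul hE hG hGS hlev
    rw [hEe, hGg, hSτ, ← ENNReal.ofReal_mul hα.le, ← ENNReal.ofReal_mul hτ.le,
      ENNReal.ofReal_le_ofReal_iff (by positivity)] at h1
    have h2 := Real.log_le_log (by positivity) h1
    rw [Real.log_mul hα.ne' hg.ne', Real.log_mul hτ.ne' he.ne'] at h2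
    -- In α g ≤ τ e the factors e, A and τ cancel, which leaves a lower bound for u R.
    rw [div_mul_eq_mul_div, ← add_div, div_le_iff₀ hu0]
    linarith
  · subst hn
    have h1 := path_count_le hn0 hE hG hS hGS hα he hg (mul_pos hM hA) hτ hη0 hη1 hEe hGg hSτ.le
      hGA hlev rfl rfl
    set β : ℝ := α * g / (4 * (d - 1 : ℕ) * e) with hβ
    have hβ0 : 0 < β := by positivity
    have h2 := log_path_count_le hn0 hα hβ0 (by positivity) (mul_pos hM hA) hτ hη0 h1
    rw [Real.log_div hβ0.ne' (by positivity), Real.log_mul hM.ne' hA.ne'] at h2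
    have hy : Real.log β = Real.log α + Real.log g - Real.log e -
        Real.log (4 * (d - 1 : ℕ)) := by
      rw [hβ, Real.log_div (by positivity) (by positivity), Real.log_mul hα.ne' hg.ne',
        Real.log_mul (by positivity) he.ne']
      ring
    have h3 := upper_numerics hn0' (D := d / (d - 1)) (by
        rw [hnd, add_sub_cancel_right, add_div, div_self hn0'.ne']) hP hη0
      (by rw [logRatio, hnd]) hlα hlg hy h2
    rw [div_mul_eq_mul_div, ← sub_div, le_div_iff₀ hPu]
    linarith

theorem volume_le_of_logRatio {d : ℕ} {ε A τ e₁ e₂ c k c' k' : ℝ} (hε : 0 < ε) (he₁ : 0 < e₁)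
    (he₂ : 0 < e₂) (h₁ : logRatio d A τ e₁ ≤ c' - k' * Real.log ε)
    (h₂ : c + k * Real.log ε ≤ logRatio d A τ e₂) :
    e₁ ≤ Real.exp (c' - c) * ε ^ (-(k + k')) * e₂ := by
  have hp := Real.rpow_pos_of_pos hε (-(k + k'))
  rw [← Real.log_le_log_iff he₁ (by positivity), Real.log_mul (by positivity) he₂.ne',
    Real.log_mul (Real.exp_ne_zero _) hp.ne', Real.log_exp, Real.log_rpow hε]
  unfold logRatio at h₁ h₂
  linarith

end RestrictedXray


/-! ### Comparison of the two sets. -/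

theorem mainTheorem6 (d : ℕ) (hd : 3 ≤ d) (θ : ℝ) (hθ0 : 0 < θ) (hθ1 : θ < 1)
    (a b m M : ℝ) (ha : 0 < a) (hb : 0 < b) (hm : 0 < m) (hM : 0 < M) :
    ∃ c C k : ℝ, 0 < c ∧ 0 < C ∧ 0 < k ∧
      ∀ (ε : ℝ), 0 < ε →
      ∀ (E₁ E₂ F F' : Set (RestrictedXray.Space d)) (A : ℝ) (T : Set ℝ),
        NullMeasurableSet E₁ volume → NullMeasurableSet E₂ volume →
        NullMeasurableSet F volume → NullMeasurableSet F' volume →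
        0 < volume E₁ → volume E₁ < ∞ →
        0 < volume E₂ → volume E₂ < ∞ →
        0 < volume F → volume F < ∞ →
        0 < A →
        RestrictedXray.FibreComparable m M (RestrictedXray.rDual d θ) A T F →
        F' ⊆ F →
        ENNReal.ofReal (a * ε ^ b) * volume F ≤ volume F' →
        (∀ᵐ z : RestrictedXray.Space d, z ∈ F' →
          RestrictedXray.threshold d θ ε E₁ F ≤ RestrictedXray.xray d (RestrictedXray.chi E₁) z) →
        (∀ᵐ z : RestrictedXray.Space d, z ∈ F' →
          RestrictedXray.threshold d θ ε E₂ F ≤ RestrictedXray.xray d (RestrictedXray.chi E₂) z) →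
        ENNReal.ofReal (c * ε ^ k) * volume E₁ ≤ volume E₂ ∧
          volume E₂ ≤ ENNReal.ofReal (C * ε ^ (-k)) * volume E₁ := by
  open RestrictedXray in
  obtain ⟨c, k, hk, c', k', hk', H⟩ := log_volume_bounds hd hθ0 hθ1 ha hb hm hM
  refine ⟨Real.exp (c - c'), Real.exp (c' - c), k + k', Real.exp_pos _, Real.exp_pos _,
    add_pos hk hk', ?_⟩
  intro ε hε E₁ E₂ F F' A T hE₁ hE₂ hF hF' hE₁0 hE₁t hE₂0 hE₂t hF0 hFt hA hcomp hsub hlarge hX₁ hX₂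
  have hd' : (3 : ℝ) ≤ d := by exact_mod_cast hd
  have hr : 0 < rDual d θ := by
    rw [← one_div_pos, one_div_rDual hd hθ0 hθ1]
    have : (0 : ℝ) < d - 1 := by linarith
    positivity
  have hq : 0 < qDual d θ := by
    rw [← one_div_pos, one_div_qDual (by omega) hθ0]
    have : 2 * θ / ((d : ℝ) + 2) * d / 2 = θ * (d / (d + 2)) := by field_simp
    have h2 : (d : ℝ) / (d + 2) < 1 := by rw [div_lt_one (by positivity)]; linarith
    rw [this]
    nlinarith
  have hεb := Real.rpow_pos_of_pos hε b
  -- These data come from `F` and `F'` alone, so both sets are measured against the same critical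
  -- size.
  obtain ⟨G, S, τ, g, hG, hS, hτ, hg, hSτ, hGg, hgl, hGS, hGA, hGF', hnorm⟩ :=
    exists_regular_part hr hq hm hM hA (mul_pos ha hεb) hF hF' hF0 hFt hcomp hsub hlarge
  have key : ∀ E : Set (Space d), NullMeasurableSet E volume → 0 < volume E → volume E < ∞ →
      (∀ᵐ z : Space d, z ∈ F' → threshold d θ ε E F ≤ xray d (chi E) z) →
      c + k * Real.log ε ≤ logRatio d A τ (volume E).toReal ∧
        logRatio d A τ (volume E).toReal ≤ c' - k' * Real.log ε := by
    intro E hE hE0 hEt hX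
    obtain ⟨E', -, hE', hEE'⟩ := hE.exists_measurable_superset_ae_eq
    set e := (volume E).toReal
    have he : 0 < e := ENNReal.toReal_pos hE0.ne' hEt.ne
    have hEe : volume E = ENNReal.ofReal e := (ENNReal.ofReal_toReal hEt.ne).symm
    have hlev : ENNReal.ofReal (level d θ ε m M A τ e) ≤ threshold d θ ε E F := by
      have hep := Real.rpow_pos_of_pos he (1 / pExp d θ)
      rw [level, threshold, hEe, ENNReal.ofReal_rpow_of_pos he,
        ENNReal.ofReal_mul (by positivity), ENNReal.ofReal_mul hε.le, mul_assoc _ (mixedNorm _ _ _)]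
      gcongr
    -- The lower bound for the X-ray transform holds only almost everywhere; a null set of lines is
    -- removed so that it holds on every line.
    let G' : Set (Space d) := G ∩ {f | ENNReal.ofReal (level d θ ε m M A τ e) ≤ lineMeasure E' f}
    have hG' : MeasurableSet G' :=
      hG.inter (measurableSet_le measurable_const (measurable_lineMeasure hE'))
    have hGG' : G' =ᵐ[volume] G := by
      filter_upwards [hGF', hX, ae_xray_eq_lineMeasure hE' hEE'.symm] with z h1 h2 h3
      refine propext ⟨fun h => h.1, fun h => ⟨h, ?_⟩⟩
      exact hlev.trans (h3 ▸ h2 (h1 h))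
    refine H ε A τ g e E' G' S hε hA hτ he hg hE' hG' hS ((measure_congr hEE').trans hEe)
      ((measure_congr hGG').trans hGg) hSτ hgl (fun f hf => hGS f hf.1) (fun t => ?_)
      fun f hf => hf.2
    exact (measure_mono (Set.preimage_mono Set.inter_subset_left)).trans (hGA t)
  have h₁ := key E₁ hE₁ hE₁0 hE₁t hX₁
  have h₂ := key E₂ hE₂ hE₂0 hE₂t hX₂
  have hv₁ := ENNReal.ofReal_toReal hE₁t.ne
  have hv₂ := ENNReal.ofReal_toReal hE₂t.ne
  have he₁ := ENNReal.toReal_pos hE₁0.ne' hE₁t.ne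
  have he₂ := ENNReal.toReal_pos hE₂0.ne' hE₂t.ne
  have hεk := Real.rpow_pos_of_pos hε (k + k')
  have hεk' := Real.rpow_pos_of_pos hε (-(k + k'))
  rw [← hv₁, ← hv₂, ← ENNReal.ofReal_mul (by positivity), ← ENNReal.ofReal_mul (by positivity)]
  constructor
  · refine ENNReal.ofReal_le_ofReal ?_
    have h := volume_le_of_logRatio hε he₁ he₂ h₁.2 h₂.1
    calc _ ≤ Real.exp (c - c') * ε ^ (k + k') *
          (Real.exp (c' - c) * ε ^ (-(k + k')) * (volume E₂).toReal) := by gcongr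
      _ = (Real.exp (c - c') * Real.exp (c' - c)) * (ε ^ (k + k') * ε ^ (-(k + k'))) *
          (volume E₂).toReal := by ring
      _ = _ := by
        rw [← Real.exp_add, ← Real.rpow_add hε]; simp
  · exact ENNReal.ofReal_le_ofReal (volume_le_of_logRatio hε he₂ he₁ h₂.2 h₁.1)

end
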